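/- \textbf{Setting.} Let $N\ge 1$ arms and $T$ rounds be given. In round $t$ there is a weighted directed graph $G_t$ on $[N]$ with weights $s_{t,(i,j)}\in[0,1]$ and $s_{t,(i,i)}=1$, and a loss vector $\ell_t\in[0,1]^N$. The learner plays $I_t$, suffers $\ell_{t,I_t}$, and observes $G_t$ and, for every arm $i$, the feedback $c_{t,i}=s_{t,(I_t,i)}\ell_{t,i}+(1-s_{t,(I_t,i)})\xi_{t,i}$. The noise $\xi_{t,i}$ is zero-mean, satisfies $|\xi_{t,i}|\le R$ (with $R\ge0$), and is independent of all other noise terms, of the history before round $t$ and of $I_t$. The graphs $G_1,\dots,G_T$ are fixed in advance (oblivious adversary); the losses $\ell_t$ may be fixed in advance or may depend on the history before round $t$. The regret is $R_T=\max_{i}\mathbb E\big[\sum_{t=1}^T\ell_{t,I_t}-\sum_{t=1}^T\ell_{t,i}\big]$. For $\varepsilon\in(0,1]$ let $G_t(\varepsilon)$ be the unweighted directed graph with an arc $i\to j$ whenever $s_{t,(i,j)}\ge\varepsilon$, let $\alpha(G_t(\varepsilon))$ be its independence number (the largest number of nodes no two distinct ones of which are joined by an arc in either direction), and let $\alpha^*_t=\min_{\varepsilon\in(0,1]}\alpha(G_t(\varepsilon))/\varepsilon^2$.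 \textbf{Algorithm} (Exp3-IXt, with thresholds $\varepsilon_t$, learning rate $\eta>0$ and parameter $\gamma\ge0$). Start from $\widehat L_{0,i}=0$. In round $t$, draw $I_t$ from $p_{t,i}\propto\exp(-\eta\widehat L_{t-1,i})$ and set $\widehat L_{t,i}=\widehat L_{t-1,i}+\widehat\ell_{t,i}$, where \[ \widehat\ell_{t,i}=\frac{c_{t,i}\,\mathbb 1\{s_{t,(I_t,i)}\ge\varepsilon_t\}}{\sum_{j=1}^N p_{t,j}\,s_{t,(j,i)}\,\mathbb 1\{s_{t,(j,i)}\ge\varepsilon_t\}+\gamma}. \] \textbf{Theorem.} There are universal constants $C>0$ and $k\in\mathbb N$ such that the following holds for all $N\ge1$, $T$, $R\ge0$ and all graphs $G_1,\dots,G_T$ as above. For all thresholds $\varepsilon_1,\dots,\varepsilon_T\in(0,1]$ there are constants $\eta>0$ and $\gamma\ge0$ (depending on $N$, $T$, $R$, the graphs and the thresholds, but not on the losses or the noise) for which the regret of Exp3-IXt satisfies \[ R_T\le C\,(1+\log(NT))^k\,(1+R)\sqrt{\sum_{t=1}^T\frac{\alpha(G_t(\varepsilon_t))}{\varepsilon_t^2}}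 \] for all losses and all noise (for $T=0$ the logarithm is read as $0$). Moreover, in every round a threshold attaining the minimum $\alpha^*_t$ exists, and if every $\varepsilon_t$ is such a threshold, then there are constants $\eta>0$ and $\gamma\ge0$ for which \[ R_T\le C\,(1+\log(NT))^k\,(1+R)\sqrt{\sum_{t=1}^T\alpha^*_t}. \] -/

import Mathlib

open MeasureTheory ProbabilityTheory

universe u

/-- `s` is a sequence of weighted directed graphs on `N` nodes (`s t i j` is the weight of the arc
`i → j` in round `t`) whose weights lie in `[0,1]` and whose self-loops have weight one,
during the rounds `0, …, T - 1`. -/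
structure IsObservationGraphs {N : ℕ} (T : ℕ) (s : ℕ → Fin N → Fin N → ℝ) : Prop where
  nonneg : ∀ t < T, ∀ i j, 0 ≤ s t i j
  le_one : ∀ t < T, ∀ i j, s t i j ≤ 1
  self_eq_one : ∀ t < T, ∀ i, s t i i = 1

/-- The unweighted directed graph `G(e)` that keeps the arcs of weight at least `e`. -/
def thresholdGraph {N : ℕ} (w : Fin N → Fin N → ℝ) (e : ℝ) : Digraph (Fin N) where
  Adj i j := e ≤ w i j

/-- The independence number of a directed graph: the size of a largest set of nodes no two distinct
members of which are joined by an arc, in either direction. -/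
noncomputable def independenceNumber {N : ℕ} (G : Digraph (Fin N)) : ℕ :=
  G.toSimpleGraphInclusive.indepNum

/-- The quantity `α(G(e)) / e²` (to be used for `e > 0` only; for `e = 0` it means `+∞`). -/
noncomputable def independenceRatio {N : ℕ} (w : Fin N → Fin N → ℝ) (e : ℝ) : ℝ :=
  (independenceNumber (thresholdGraph w e) : ℝ) / e ^ 2

/-- The effective independence number `α* = min_e α(G(e)) / e²`. The threshold `0`, at which the
ratio is `+∞`, is left out. -/
noncomputable def effectiveIndependenceNumber {N : ℕ} (w : Fin N → Fin N → ℝ) : ℝ :=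
  sInf (independenceRatio w '' Set.Ioc 0 1)

/-- `e` is an optimal threshold: it minimizes `α(G(e)) / e²`. -/
def IsOptimalThreshold {N : ℕ} (w : Fin N → Fin N → ℝ) (e : ℝ) : Prop :=
  e ∈ Set.Ioc (0 : ℝ) 1 ∧ IsMinOn (independenceRatio w) (Set.Ioc 0 1) e

/-- The exponential weights distribution `p i ∝ exp (- η * L i)`. -/
noncomputable def expWeights {N : ℕ} (η : ℝ) (L : Fin N → ℝ) (i : Fin N) : ℝ :=
  Real.exp (-η * L i) / ∑ j, Real.exp (-η * L j)

/-- The weight `w j i`, set to zero when it is below the threshold `e`. -/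
noncomputable def truncatedWeight {N : ℕ} (w : Fin N → Fin N → ℝ) (e : ℝ) (j i : Fin N) : ℝ :=
  if e ≤ w j i then w j i else 0

/-- The thresholded loss estimate with implicit exploration, from the feedback `c`, when the arm `a`
was drawn from the distribution `p`. -/
noncomputable def lossEstimate {N : ℕ} (w : Fin N → Fin N → ℝ) (e γ : ℝ) (p : Fin N → ℝ)
    (a : Fin N) (c : Fin N → ℝ) (i : Fin N) : ℝ :=
  (if e ≤ w a i then c i else 0) / ((∑ j, p j * truncatedWeight w e j i) + γ)

/-- The cumulative loss estimates that Exp3-IXt holds at the beginning of round `t` (rounds are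
numbered from `0`), when the arms `a` were played and the feedback `c` was received. -/
noncomputable def cumulativeEstimate {N : ℕ} (s : ℕ → Fin N → Fin N → ℝ) (ε η γ : ℕ → ℝ)
    (a : ℕ → Fin N) (c : ℕ → Fin N → ℝ) : ℕ → Fin N → ℝ
  | 0 => fun _ => 0
  | t + 1 => fun i =>
      cumulativeEstimate s ε η γ a c t i +
        lossEstimate (s t) (ε t) (γ t) (expWeights (η t) (cumulativeEstimate s ε η γ a c t))
          (a t) (c t) i

/-- The distribution from which Exp3-IXt draws its arm in round `t`. -/
noncomputable def playDistribution {N : ℕ} (s : ℕ → Fin N → Fin N → ℝ) (ε η γ : ℕ → ℝ)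
    (a : ℕ → Fin N) (c : ℕ → Fin N → ℝ) (t : ℕ) : Fin N → ℝ :=
  expWeights (η t) (cumulativeEstimate s ε η γ a c t)

/-- The noisy feedback about arm `i` in round `t`, when the losses are `l`, the noise is `x` and
the arms `a` are played. -/
def feedback {N : ℕ} (s : ℕ → Fin N → Fin N → ℝ) (l x : ℕ → Fin N → ℝ) (a : ℕ → Fin N)
    (t : ℕ) (i : Fin N) : ℝ :=
  s t (a t) i * l t i + (1 - s t (a t) i) * x t i

/-- The environment and the noise during the rounds `0, …, T - 1`. The sigma-algebra `𝓕 t` is the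
history before round `t`, so that the arm `I t` and the noise `ξ t` are `𝓕 (t + 1)`-measurable.
The losses `ℓ t` are chosen in `[0,1]` in knowledge of the history `𝓕 t` (deterministic losses are a
special case). The noise terms are centred, bounded by `R`, and independent of one another, of the
history and of the arm just played. -/
structure IsNoisyEnvironment {N : ℕ} {Ω : Type*} {mΩ : MeasurableSpace Ω} (μ : Measure Ω)
    (T : ℕ) (R : ℝ) (𝓕 : Filtration ℕ mΩ) (ℓ ξ : ℕ → Fin N → Ω → ℝ) (I : ℕ → Ω → Fin N) :
    Prop where
  loss_measurable : ∀ t < T, ∀ i, Measurable[𝓕 t] (ℓ t i)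
  loss_mem : ∀ t < T, ∀ i ω, ℓ t i ω ∈ Set.Icc (0 : ℝ) 1
  noise_measurable : ∀ t < T, ∀ i, Measurable[𝓕 (t + 1)] (ξ t i)
  noise_bounded : ∀ t < T, ∀ i, ∀ᵐ ω ∂μ, |ξ t i ω| ≤ R
  noise_mean : ∀ t < T, ∀ i, ∫ ω, ξ t i ω ∂μ = 0
  noise_indep : ∀ t < T, ∀ i,
    Indep (MeasurableSpace.comap (ξ t i) inferInstance)
      (𝓕 t ⊔ MeasurableSpace.comap (I t) ⊤ ⊔
        ⨆ j : {j : Fin N // j ≠ i}, MeasurableSpace.comap (ξ t j) inferInstance) μ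

/-- The arms `I` are played by Exp3-IXt with thresholds `ε`, learning rates `η` and implicit
exploration parameters `γ`: given the history, the arm of each round is drawn from the distribution
that the algorithm prescribes. -/
structure IsExp3IXt {N : ℕ} {Ω : Type*} {mΩ : MeasurableSpace Ω} (μ : Measure Ω)
    (T : ℕ) (s : ℕ → Fin N → Fin N → ℝ) (ε η γ : ℕ → ℝ)
    (𝓕 : Filtration ℕ mΩ) (ℓ ξ : ℕ → Fin N → Ω → ℝ) (I : ℕ → Ω → Fin N) : Prop where
  arm_measurable : ∀ t < T, Measurable[𝓕 (t + 1)] (I t)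
  arm_law : ∀ t < T, ∀ i,
    μ[Set.indicator {ω | I t ω = i} (fun _ => (1 : ℝ)) | 𝓕 t] =ᵐ[μ] fun ω =>
      playDistribution s ε η γ (fun r => I r ω)
        (feedback s (fun r j => ℓ r j ω) (fun r j => ξ r j ω) (fun r => I r ω)) t i

/-- The total expected regret after `T` rounds, `max_i E[∑ₜ ℓ_{t,I_t} - ∑ₜ ℓ_{t,i}]`. -/
noncomputable def expectedRegret {N : ℕ} {Ω : Type*} {mΩ : MeasurableSpace Ω} (μ : Measure Ω)
    (T : ℕ) (ℓ : ℕ → Fin N → Ω → ℝ) (I : ℕ → Ω → Fin N) : ℝ :=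
  ⨆ i : Fin N, ∫ ω, ((∑ t ∈ Finset.range T, ℓ t (I t ω) ω) - ∑ t ∈ Finset.range T, ℓ t i ω) ∂μ

/-- Exp3-IXt, run for `T` rounds on the graphs `s` with thresholds `ε` and the constant parameters
`η` and `γ`, has expected regret at most `B`, whatever the losses and the noise (with bound `R`). -/
def RegretAtMost {N : ℕ} (T : ℕ) (R : ℝ) (s : ℕ → Fin N → Fin N → ℝ) (ε : ℕ → ℝ) (η γ B : ℝ) :
    Prop :=
  ∀ (Ω : Type u) (mΩ : MeasurableSpace Ω) (μ : Measure Ω) (𝓕 : Filtration ℕ mΩ)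
    (ℓ ξ : ℕ → Fin N → Ω → ℝ) (I : ℕ → Ω → Fin N),
    IsProbabilityMeasure μ →
    IsNoisyEnvironment μ T R 𝓕 ℓ ξ I →
    IsExp3IXt μ T s ε (fun _ => η) (fun _ => γ) 𝓕 ℓ ξ I →
    expectedRegret μ T ℓ I ≤ B

/-!
The first ingredient is the second-order regret bound of exponential weights, which holds pathwise
for losses of either sign as soon as `|η * x| ≤ 1` (`expWeights_regret_le`). Applied to the loss
estimates it is available because the feedback is bounded by `1 + R` and the denominators are at
least `γ`, so that `η (1 + R) ≤ γ` suffices.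

Given the history, the noise averages out of the estimate of arm `i`, whose conditional mean is
`ℓ i * S i / (S i + γ)`, where `S i` is the `observedWeight`. So the estimates never exceed the
losses in the mean, and the bias costs at most `γ ∑ p i / (S i + γ)` per round. The conditional
second moment is at most `(1 + R)² P i / (S i + γ)²`, where `P i ≤ S i / ε` is the
`observationProb` (`IsRound.integral_regret_le`, `IsRound.integral_sum_mul_lossEstimate_sq_le`).

Both error terms are controlled by `∑ p i / (P i + γ) ≤ 2 α log (1 + 1 / γ)`
(`sum_div_inProbability_le`). This rests on a weighted Caro–Wei bound: together with the
Cauchy–Schwarz inequality it shows that among any set of nodes of weight `W` there is one whose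
in-neighbourhood has weight at least `W / (2 α)`. Removing such nodes one after the other turns the
sum into a telescoping sum of logarithms.

Altogether the regret is at most `log N / η + (η (1 + R)² + γ) * 2 A log (1 + 1 / γ)` with
`A = ∑ α(G_t(ε_t)) / ε_t²`. The choice `γ = 1 / √A`, `η = γ / (1 + R)` gives the claim if `√A < T`,
for then `log (1 + 1 / γ) ≤ log (1 + T)`; if `√A ≥ T` then the trivial bound `T` is enough.
-/

/-! ### Independent sets and in-neighbourhood weights -/

/-- Weighted Caro–Wei bound for a reflexive symmetric relation `r`, by the greedy algorithm: pick a
node whose neighbourhood is lightest, discard this neighbourhood (which contributes at most one to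
the sum on the left), and repeat. -/
theorem exists_independent_sum_div_le_card {ι : Type*} [DecidableEq ι] (r : ι → ι → Prop)
    [DecidableRel r] (hrefl : ∀ i, r i i) (hsymm : ∀ i j, r i j → r j i) {p : ι → ℝ}
    (hp : ∀ i, 0 < p i) (V : Finset ι) :
    ∃ S ⊆ V, (∀ i ∈ S, ∀ j ∈ S, i ≠ j → ¬ r i j) ∧
      ∑ i ∈ V, p i / (∑ j ∈ V with r i j, p j) ≤ S.card := by
  induction V using Finset.strongInduction with
  | H V ih =>
  rcases V.eq_empty_or_nonempty with rfl | hV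
  · exact ⟨∅, by simp⟩
  obtain ⟨i, hi, hmin⟩ := V.exists_min_image (fun i => ∑ j ∈ V with r i j, p j) hV
  have hss : V.filter (fun j => ¬ r i j) ⊂ V :=
    Finset.filter_ssubset.2 ⟨i, hi, by simpa using hrefl i⟩
  obtain ⟨S, hSV, hS, hle⟩ := ih _ hss
  have hpos : ∀ W : Finset ι, ∀ k ∈ W, 0 < ∑ j ∈ W with r k j, p j := fun W k hk =>
    Finset.sum_pos (fun j _ => hp j) ⟨k, by simp [hk, hrefl k]⟩
  have hiS : i ∉ S := fun h => (Finset.mem_filter.1 (hSV h)).2 (hrefl i)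
  refine ⟨insert i S, ?_, ?_, ?_⟩
  · exact Finset.insert_subset hi (hSV.trans (Finset.filter_subset _ _))
  · intro a ha b hb hab
    rcases Finset.mem_insert.1 ha with rfl | haS <;> rcases Finset.mem_insert.1 hb with rfl | hbS
    · exact absurd rfl hab
    · exact (Finset.mem_filter.1 (hSV hbS)).2
    · exact fun h => (Finset.mem_filter.1 (hSV haS)).2 (hsymm _ _ h)
    · exact hS a haS b hbS hab
  · rw [Finset.card_insert_of_notMem hiS, ← Finset.sum_filter_add_sum_filter_not V (r i),
      Nat.cast_add, Nat.cast_one, add_comm]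
    refine add_le_add (le_trans ?_ hle) ?_
    · refine Finset.sum_le_sum fun k hk => ?_
      refine div_le_div_of_nonneg_left (hp k).le (hpos _ k hk) ?_
      exact Finset.sum_le_sum_of_subset_of_nonneg
        (Finset.filter_subset_filter _ (Finset.filter_subset _ _)) fun j _ _ => (hp j).le
    · calc ∑ k ∈ V with r i k, p k / (∑ j ∈ V with r k j, p j)
          ≤ ∑ k ∈ V with r i k, p k / (∑ j ∈ V with r i j, p j) := by
            refine Finset.sum_le_sum fun k hk => ?_
            exact div_le_div_of_nonneg_left (hp k).le (hpos V i hi)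
              (hmin k (Finset.mem_filter.1 hk).1)
        _ = 1 := by
            rw [← Finset.sum_div, div_self (hpos V i hi).ne']

theorem independent_card_le_independenceNumber {N : ℕ} (G : Digraph (Fin N)) (S : Finset (Fin N))
    (hS : ∀ i ∈ S, ∀ j ∈ S, i ≠ j → ¬ (G.Adj i j ∨ G.Adj j i)) :
    S.card ≤ independenceNumber G := by
  refine SimpleGraph.IsIndepSet.card_le_indepNum ?_
  intro i hi j hj hij h
  exact hS i hi j hj hij h.2

theorem one_le_independenceNumber {N : ℕ} (hN : 1 ≤ N) (G : Digraph (Fin N)) :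
    1 ≤ independenceNumber G := by
  have h := independent_card_le_independenceNumber G {⟨0, hN⟩} fun i hi j hj hij =>
    absurd ((Finset.mem_singleton.1 hi).trans (Finset.mem_singleton.1 hj).symm) hij
  simpa using h

/-- A Motzkin–Straus type inequality for directed graphs with self-loops. It follows from the
weighted Caro–Wei bound and the Cauchy–Schwarz inequality; the factor two comes from counting arcs
in both directions. -/
theorem sq_sum_le_independenceNumber_mul {N : ℕ} (G : Digraph (Fin N)) [DecidableRel G.Adj]
    (hG : ∀ i, G.Adj i i) {p : Fin N → ℝ} (hp : ∀ i, 0 < p i) (V : Finset (Fin N)) :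
    (∑ i ∈ V, p i) ^ 2 ≤
      2 * independenceNumber G * ∑ i ∈ V, p i * ∑ j ∈ V with G.Adj j i, p j := by
  set r : Fin N → Fin N → Prop := fun i j => G.Adj i j ∨ G.Adj j i with hr
  obtain ⟨S, -, hS, hle⟩ := exists_independent_sum_div_le_card r (fun i => Or.inl (hG i))
    (fun i j h => h.symm) hp V
  have hα : (S.card : ℝ) ≤ independenceNumber G :=
    Nat.cast_le.2 (independent_card_le_independenceNumber G S hS)
  have hpos : ∀ k ∈ V, 0 < ∑ j ∈ V with r k j, p j := fun k hk =>
    Finset.sum_pos (fun j _ => hp j) ⟨k, by simp [hk, hr, hG k]⟩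
  have hcs : (∑ i ∈ V, p i) ^ 2 ≤ (∑ i ∈ V, p i / (∑ j ∈ V with r i j, p j)) *
      ∑ i ∈ V, p i * (∑ j ∈ V with r i j, p j) := by
    refine Finset.sum_sq_le_sum_mul_sum_of_sq_le_mul V
      (fun i hi => (div_pos (hp i) (hpos i hi)).le)
      (fun i hi => (mul_pos (hp i) (hpos i hi)).le) fun i hi => ?_
    have := (hpos i hi).ne'
    apply le_of_eq
    field_simp
  have hsplit : ∑ i ∈ V, p i * (∑ j ∈ V with r i j, p j) ≤
      2 * ∑ i ∈ V, p i * ∑ j ∈ V with G.Adj j i, p j := by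
    have h1 : ∑ i ∈ V, p i * ∑ j ∈ V with G.Adj i j, p j =
        ∑ i ∈ V, p i * ∑ j ∈ V with G.Adj j i, p j := by
      simp_rw [Finset.mul_sum, Finset.sum_filter]
      rw [Finset.sum_comm]
      refine Finset.sum_congr rfl fun i _ => Finset.sum_congr rfl fun j _ => ?_
      split_ifs
      · exact mul_comm _ _
      · rfl
    rw [two_mul]
    nth_rewrite 1 [← h1]
    rw [← Finset.sum_add_distrib]
    refine Finset.sum_le_sum fun i _ => ?_
    rw [← mul_add]
    refine mul_le_mul_of_nonneg_left ?_ (hp i).le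
    simp_rw [Finset.sum_filter]
    rw [← Finset.sum_add_distrib]
    refine Finset.sum_le_sum fun j _ => ?_
    have := (hp j).le
    simp only [hr]
    split_ifs <;> simp_all
  have hq : 0 ≤ ∑ i ∈ V, p i * (∑ j ∈ V with r i j, p j) :=
    Finset.sum_nonneg fun i hi => (mul_pos (hp i) (hpos i hi)).le
  calc (∑ i ∈ V, p i) ^ 2
      ≤ independenceNumber G * ∑ i ∈ V, p i * (∑ j ∈ V with r i j, p j) :=
        hcs.trans (mul_le_mul_of_nonneg_right (hle.trans hα) hq)
    _ ≤ independenceNumber G * (2 * ∑ i ∈ V, p i * ∑ j ∈ V with G.Adj j i, p j) :=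
        mul_le_mul_of_nonneg_left hsplit (Nat.cast_nonneg _)
    _ = _ := by ring

theorem exists_sum_le_independenceNumber_mul {N : ℕ} (G : Digraph (Fin N)) [DecidableRel G.Adj]
    (hG : ∀ i, G.Adj i i) {p : Fin N → ℝ} (hp : ∀ i, 0 < p i) {V : Finset (Fin N)}
    (hV : V.Nonempty) :
    ∃ i ∈ V, ∑ j ∈ V, p j ≤ 2 * independenceNumber G * ∑ j ∈ V with G.Adj j i, p j := by
  by_contra! h
  have hW : 0 < ∑ j ∈ V, p j := Finset.sum_pos (fun j _ => hp j) hV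
  have h1 := sq_sum_le_independenceNumber_mul G hG hp V
  have h2 : 2 * independenceNumber G * ∑ i ∈ V, p i * ∑ j ∈ V with G.Adj j i, p j <
      ∑ i ∈ V, p i * ∑ j ∈ V, p j := by
    rw [Finset.mul_sum]
    refine Finset.sum_lt_sum_of_nonempty hV fun i hi => ?_
    have := mul_lt_mul_of_pos_left (h i hi) (hp i)
    linarith
  rw [← Finset.sum_mul, ← sq] at h2
  exact absurd h1 (not_le.2 h2)

theorem div_add_le_log_sub_log {x W d : ℝ} (hd : 0 < d) (hx : 0 ≤ x) (hxW : x ≤ W) :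
    x / (W + d) ≤ Real.log (W + d) - Real.log (W - x + d) := by
  have h1 : 0 < W + d := by linarith
  have h2 : 0 < W - x + d := by linarith
  have h := Real.log_le_sub_one_of_pos (div_pos h2 h1)
  rw [Real.log_div h2.ne' h1.ne'] at h
  have h3 : x / (W + d) = 1 - (W - x + d) / (W + d) := by
    field_simp
    ring
  linarith

/-- The nodes are removed one by one, each time one whose in-neighbourhood carries at least a
fraction `1 / (2 α)` of the remaining weight; the resulting sum telescopes after comparison with the
logarithm. -/
theorem sum_div_inWeight_le_log {N : ℕ} (hN : 1 ≤ N) (G : Digraph (Fin N)) [DecidableRel G.Adj]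
    (hG : ∀ i, G.Adj i i) {p : Fin N → ℝ} (hp : ∀ i, 0 < p i) {c : ℝ} (hc : 0 < c)
    (V : Finset (Fin N)) :
    ∑ i ∈ V, p i / ((∑ j ∈ V with G.Adj j i, p j) + c) ≤
      2 * independenceNumber G * (Real.log ((∑ i ∈ V, p i) + 2 * independenceNumber G * c) -
        Real.log (2 * independenceNumber G * c)) := by
  set b : ℝ := 2 * independenceNumber G with hb
  have hα : (1 : ℝ) ≤ independenceNumber G := by exact_mod_cast one_le_independenceNumber hN G
  have hb0 : 0 < b := by linarith
  induction V using Finset.strongInduction with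
  | H V ih =>
  rcases V.eq_empty_or_nonempty with rfl | hV
  · simp
  obtain ⟨i, hi, hle⟩ := exists_sum_le_independenceNumber_mul G hG hp hV
  have ih' := ih _ (Finset.erase_ssubset hi)
  have hpi : p i ≤ ∑ j ∈ V, p j := Finset.single_le_sum (fun j _ => (hp j).le) hi
  have hsum : ∑ j ∈ V.erase i, p j = ∑ j ∈ V, p j - p i := by
    rw [← Finset.add_sum_erase V p hi]
    ring
  rw [hsum] at ih'
  have hlog := div_add_le_log_sub_log (mul_pos hb0 hc) (hp i).le hpi
  have hpos : ∀ W : Finset (Fin N), ∀ k, 0 < (∑ j ∈ W with G.Adj j k, p j) + c := fun W k =>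
    add_pos_of_nonneg_of_pos (Finset.sum_nonneg fun j _ => (hp j).le) hc
  have hfirst : p i / ((∑ j ∈ V with G.Adj j i, p j) + c) ≤
      b * (p i / (∑ j ∈ V, p j + b * c)) := by
    have hden : 0 < ∑ j ∈ V, p j + b * c :=
      add_pos_of_pos_of_nonneg ((hp i).trans_le hpi) (mul_pos hb0 hc).le
    rw [← mul_div_assoc, div_le_div_iff₀ (hpos V i) hden]
    have := mul_le_mul_of_nonneg_left hle (hp i).le
    linarith
  have hrest : ∑ k ∈ V.erase i, p k / ((∑ j ∈ V with G.Adj j k, p j) + c) ≤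
      ∑ k ∈ V.erase i, p k / ((∑ j ∈ V.erase i with G.Adj j k, p j) + c) := by
    refine Finset.sum_le_sum fun k _ => ?_
    refine div_le_div_of_nonneg_left (hp k).le (hpos _ k) ?_
    refine add_le_add_left (Finset.sum_le_sum_of_subset_of_nonneg
      (Finset.filter_subset_filter _ (Finset.erase_subset _ _)) fun j _ _ => (hp j).le) _
  rw [← Finset.add_sum_erase V _ hi]
  have := mul_le_mul_of_nonneg_left hlog hb0.le
  linarith

/-- The graph-theoretic heart of the regret bound: the sum of the ratios of the probability of an
arm to the probability of observing it is of the order of the independence number. -/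
theorem sum_div_inProbability_le {N : ℕ} (hN : 1 ≤ N) (G : Digraph (Fin N)) [DecidableRel G.Adj]
    (hG : ∀ i, G.Adj i i) {p : Fin N → ℝ} (hp : ∀ i, 0 < p i) (hp1 : ∑ i, p i = 1) {c : ℝ}
    (hc : 0 < c) :
    ∑ i, p i / ((∑ j, if G.Adj j i then p j else 0) + c) ≤
      2 * independenceNumber G * Real.log (1 + 1 / c) := by
  have hα : (1 : ℝ) ≤ independenceNumber G := by exact_mod_cast one_le_independenceNumber hN G
  have h := sum_div_inWeight_le_log hN G hG hp hc Finset.univ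
  simp_rw [Finset.sum_filter] at h
  refine h.trans (mul_le_mul_of_nonneg_left ?_ (by linarith))
  have hbc : c ≤ 2 * independenceNumber G * c := le_mul_of_one_le_left hc.le (by linarith)
  have hbc0 := hc.trans_le hbc
  rw [hp1, ← Real.log_div (by linarith) hbc0.ne', add_div, div_self hbc0.ne']
  refine Real.log_le_log (by positivity) ?_
  rw [add_comm]
  gcongr

/-! ### Optimal thresholds -/

/-- The graph `G(e)` changes only when `e` crosses one of the finitely many weights, and between two
of them the ratio `α(G(e)) / e²` decreases in `e`; so a minimum over the weights is a minimum. -/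
theorem exists_isOptimalThreshold {N : ℕ} (w : Fin N → Fin N → ℝ) :
    ∃ e, IsOptimalThreshold w e := by
  classical
  set D : Finset ℝ :=
    (insert 1 (Finset.univ.image fun x : Fin N × Fin N => w x.1 x.2)).filter
      (fun d => d ∈ Set.Ioc (0 : ℝ) 1) with hD
  have h1D : (1 : ℝ) ∈ D := by simp [hD]
  obtain ⟨e, he, hmin⟩ := D.exists_min_image (independenceRatio w) ⟨1, h1D⟩
  refine ⟨e, (Finset.mem_filter.1 he).2, fun x hx => ?_⟩
  obtain ⟨d, hd, hdmin⟩ := (D.filter (x ≤ ·)).exists_min_image id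
    ⟨1, Finset.mem_filter.2 ⟨h1D, hx.2⟩⟩
  rw [Finset.mem_filter] at hd
  have hgraph : thresholdGraph w d = thresholdGraph w x := by
    ext i j
    refine ⟨fun h => hd.2.trans h, fun h => ?_⟩
    change x ≤ w i j at h
    change d ≤ w i j
    rcases le_or_gt (w i j) 1 with hw | hw
    · refine hdmin _ (Finset.mem_filter.2 ⟨?_, h⟩)
      simp only [hD, Finset.mem_filter, Finset.mem_insert, Finset.mem_image, Finset.mem_univ,
        true_and, Prod.exists]
      exact ⟨Or.inr ⟨i, j, rfl⟩, hx.1.trans_le h, hw⟩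
    · exact ((Finset.mem_filter.1 hd.1).2.2).trans hw.le
  refine (hmin d hd.1).trans ?_
  rw [independenceRatio, independenceRatio, hgraph]
  have := hx.1
  gcongr
  exact hd.2

theorem IsOptimalThreshold.effectiveIndependenceNumber_eq {N : ℕ} {w : Fin N → Fin N → ℝ} {e : ℝ}
    (h : IsOptimalThreshold w e) : effectiveIndependenceNumber w = independenceRatio w e :=
  IsLeast.csInf_eq ⟨Set.mem_image_of_mem _ h.1, by
    rintro _ ⟨x, hx, rfl⟩
    exact h.2 hx⟩

/-! ### Exponential weights -/

theorem expWeights_pos {N : ℕ} (η : ℝ) (L : Fin N → ℝ) (i : Fin N) : 0 < expWeights η L i :=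
  div_pos (Real.exp_pos _) (Finset.sum_pos (fun _ _ => Real.exp_pos _) ⟨i, Finset.mem_univ i⟩)

theorem sum_exp_pos {N : ℕ} (hN : 1 ≤ N) (η : ℝ) (L : Fin N → ℝ) :
    0 < ∑ j, Real.exp (-η * L j) :=
  Finset.sum_pos (fun _ _ => Real.exp_pos _) ⟨⟨0, hN⟩, Finset.mem_univ _⟩

theorem sum_expWeights {N : ℕ} (hN : 1 ≤ N) (η : ℝ) (L : Fin N → ℝ) :
    ∑ i, expWeights η L i = 1 := by
  simp_rw [expWeights]
  rw [← Finset.sum_div, div_self (sum_exp_pos hN η L).ne']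

/-- One step of the potential argument, with potential `log ∑ exp (- η L)`. -/
theorem log_sum_exp_add_le {N : ℕ} (hN : 1 ≤ N) {η : ℝ} (L x : Fin N → ℝ)
    (hx : ∀ i, |η * x i| ≤ 1) :
    Real.log (∑ j, Real.exp (-η * (L j + x j))) ≤ Real.log (∑ j, Real.exp (-η * L j)) -
      η * ∑ i, expWeights η L i * x i + η ^ 2 * ∑ i, expWeights η L i * x i ^ 2 := by
  have hW := sum_exp_pos hN η L
  have hW' := sum_exp_pos hN η fun j => L j + x j
  have hratio : (∑ j, Real.exp (-η * (L j + x j))) / (∑ j, Real.exp (-η * L j)) ≤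
      1 - η * ∑ i, expWeights η L i * x i + η ^ 2 * ∑ i, expWeights η L i * x i ^ 2 := by
    calc (∑ j, Real.exp (-η * (L j + x j))) / (∑ j, Real.exp (-η * L j))
        = ∑ i, expWeights η L i * Real.exp (-(η * x i)) := by
          rw [Finset.sum_div]
          refine Finset.sum_congr rfl fun i _ => ?_
          rw [expWeights, mul_add, Real.exp_add, neg_mul η (x i)]
          ring
      _ ≤ ∑ i, expWeights η L i * (1 - η * x i + (η * x i) ^ 2) := by
          refine Finset.sum_le_sum fun i _ => ?_
          refine mul_le_mul_of_nonneg_left ?_ (expWeights_pos η L i).le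
          have h := (abs_le.1 (Real.abs_exp_sub_one_sub_id_le
            (x := -(η * x i)) (by rw [abs_neg]; exact hx i))).2
          linarith [neg_sq (η * x i)]
      _ = ∑ i, (expWeights η L i - η * (expWeights η L i * x i) +
            η ^ 2 * (expWeights η L i * x i ^ 2)) :=
          Finset.sum_congr rfl fun i _ => by ring
      _ = _ := by
          rw [Finset.sum_add_distrib, Finset.sum_sub_distrib, sum_expWeights hN,
            Finset.mul_sum, Finset.mul_sum]
  have hlog := Real.log_le_sub_one_of_pos (div_pos hW' hW)
  rw [Real.log_div hW'.ne' hW.ne'] at hlog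
  linarith

/-- The second-order regret bound of exponential weights, for losses of either sign. -/
theorem expWeights_regret_le {N : ℕ} (hN : 1 ≤ N) {η : ℝ} (hη : 0 < η) (L x : ℕ → Fin N → ℝ)
    (T : ℕ) (hL0 : ∀ i, L 0 i = 0) (hL : ∀ t < T, ∀ i, L (t + 1) i = L t i + x t i)
    (hx : ∀ t < T, ∀ i, |η * x t i| ≤ 1) (i : Fin N) :
    ∑ t ∈ Finset.range T, ((∑ j, expWeights η (L t) j * x t j) - x t i) ≤
      Real.log N / η +
        η * ∑ t ∈ Finset.range T, ∑ j, expWeights η (L t) j * x t j ^ 2 := by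
  have key : ∀ n ≤ T, Real.log (∑ j, Real.exp (-η * L n j)) ≤ Real.log N -
      η * ∑ t ∈ Finset.range n, ∑ j, expWeights η (L t) j * x t j +
      η ^ 2 * ∑ t ∈ Finset.range n, ∑ j, expWeights η (L t) j * x t j ^ 2 := by
    intro n
    induction n with
    | zero => simp [hL0]
    | succ n ih =>
      intro hn
      have h := log_sum_exp_add_le hN (L n) (x n) (hx n hn)
      simp_rw [← hL n hn] at h
      rw [Finset.sum_range_succ, Finset.sum_range_succ]
      linarith [ih (by omega)]
  have hcum : ∀ n ≤ T, L n i = ∑ t ∈ Finset.range n, x t i := by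
    intro n
    induction n with
    | zero => simp [hL0]
    | succ n ih =>
      intro hn
      rw [Finset.sum_range_succ, hL n hn, ih (by omega)]
  have hlow : -η * L T i ≤ Real.log (∑ j, Real.exp (-η * L T j)) := by
    rw [Real.le_log_iff_exp_le (sum_exp_pos hN _ _)]
    exact Finset.single_le_sum (f := fun j => Real.exp (-η * L T j))
      (fun j _ => (Real.exp_pos _).le) (Finset.mem_univ i)
  have hT := key T le_rfl
  rw [hcum T le_rfl] at hlow
  rw [Finset.sum_sub_distrib]
  have := hlow.trans hT
  refine le_of_mul_le_mul_left ?_ hη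
  rw [mul_add, mul_div_cancel₀ _ hη.ne']
  linarith

/-! ### A single round -/

/-- One round as seen at its beginning: `m` is the history, `q` the distribution of the arm `I`
given the history, `ℓ` the losses and `ξ` the noise. -/
structure IsRound {N : ℕ} {Ω : Type*} (m : MeasurableSpace Ω) {mΩ : MeasurableSpace Ω}
    (μ : Measure Ω) (R : ℝ) (q : Ω → Fin N → ℝ) (ℓ ξ : Fin N → Ω → ℝ) (I : Ω → Fin N) :
    Prop where
  le : m ≤ mΩ
  law : ∀ j, μ[Set.indicator {ω | I ω = j} (fun _ => (1 : ℝ)) | m] =ᵐ[μ] fun ω => q ω j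
  prob_measurable : ∀ j, Measurable[m] fun ω => q ω j
  prob_pos : ∀ ω j, 0 < q ω j
  prob_sum : ∀ ω, ∑ j, q ω j = 1
  arm_measurable : Measurable I
  loss_measurable : ∀ i, Measurable[m] (ℓ i)
  loss_mem : ∀ i ω, ℓ i ω ∈ Set.Icc (0 : ℝ) 1
  noise_measurable : ∀ i, Measurable (ξ i)
  noise_bounded : ∀ i, ∀ᵐ ω ∂μ, |ξ i ω| ≤ R
  noise_mean : ∀ i, ∫ ω, ξ i ω ∂μ = 0
  noise_indep : ∀ i, Indep (MeasurableSpace.comap (ξ i) inferInstance)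
    (m ⊔ MeasurableSpace.comap I ⊤) μ

/-- The mean of the truncated weight with which arm `i` is observed when the arm played is drawn
from `p`. -/
noncomputable def observedWeight {N : ℕ} (w : Fin N → Fin N → ℝ) (e : ℝ) (p : Fin N → ℝ)
    (i : Fin N) : ℝ :=
  ∑ j, p j * truncatedWeight w e j i

/-- The probability that arm `i` is observed with a weight of at least `e` when the arm played is
drawn from `p`. -/
noncomputable def observationProb {N : ℕ} (w : Fin N → Fin N → ℝ) (e : ℝ) (p : Fin N → ℝ)
    (i : Fin N) : ℝ :=
  ∑ j, if e ≤ w j i then p j else 0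

noncomputable instance {N : ℕ} (w : Fin N → Fin N → ℝ) (e : ℝ) :
    DecidableRel (thresholdGraph w e).Adj :=
  fun i j => inferInstanceAs (Decidable (e ≤ w i j))

section Weights

variable {N : ℕ} {w : Fin N → Fin N → ℝ} {e γ : ℝ} {p : Fin N → ℝ}

theorem mul_observationProb_le_observedWeight (hp : ∀ i, 0 < p i) (i : Fin N) :
    e * observationProb w e p i ≤ observedWeight w e p i := by
  rw [observationProb, observedWeight, Finset.mul_sum]
  refine Finset.sum_le_sum fun j _ => ?_
  rw [truncatedWeight]
  split_ifs with h
  · rw [mul_comm]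
    exact mul_le_mul_of_nonneg_left h (hp j).le
  · simp

theorem observationProb_nonneg (hp : ∀ i, 0 < p i) (i : Fin N) : 0 ≤ observationProb w e p i :=
  Finset.sum_nonneg fun j _ => by split_ifs <;> [exact (hp j).le; exact le_rfl]

theorem observedWeight_nonneg (he : 0 < e) (hp : ∀ i, 0 < p i) (i : Fin N) :
    0 ≤ observedWeight w e p i :=
  (mul_nonneg he.le (observationProb_nonneg hp i)).trans
    (mul_observationProb_le_observedWeight hp i)

theorem sum_div_observedWeight_le (hN : 1 ≤ N) (he : 0 < e) (he1 : e ≤ 1) (hw : ∀ i, w i i = 1)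
    (hp : ∀ i, 0 < p i) (hp1 : ∑ i, p i = 1) (hγ : 0 < γ) :
    ∑ i, p i / (observedWeight w e p i + γ) ≤
      2 * independenceNumber (thresholdGraph w e) / e * Real.log (1 + 1 / γ) := by
  have h := sum_div_inProbability_le hN (thresholdGraph w e) (fun i => by
    change e ≤ w i i
    rwa [hw i]) hp hp1 hγ
  calc ∑ i, p i / (observedWeight w e p i + γ)
      ≤ ∑ i, (p i / (observationProb w e p i + γ)) / e := by
        refine Finset.sum_le_sum fun i _ => ?_
        rw [div_div]
        have hP := observationProb_nonneg (w := w) (e := e) hp i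
        refine div_le_div_of_nonneg_left (hp i).le (by positivity) ?_
        nlinarith [mul_observationProb_le_observedWeight (w := w) (e := e) hp i]
    _ = (∑ i, p i / (observationProb w e p i + γ)) / e := (Finset.sum_div _ _ _).symm
    _ ≤ (2 * independenceNumber (thresholdGraph w e) * Real.log (1 + 1 / γ)) / e := by
        gcongr
        exact h
    _ = _ := by ring

theorem sum_mul_observationProb_div_le (hN : 1 ≤ N) (he : 0 < e) (he1 : e ≤ 1)
    (hw : ∀ i, w i i = 1) (hp : ∀ i, 0 < p i) (hp1 : ∑ i, p i = 1) (hγ : 0 < γ) :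
    ∑ i, p i * (observationProb w e p i / (observedWeight w e p i + γ) ^ 2) ≤
      2 * (independenceNumber (thresholdGraph w e) / e ^ 2) * Real.log (1 + 1 / γ) := by
  have h := sum_div_observedWeight_le hN he he1 hw hp hp1 hγ
  calc ∑ i, p i * (observationProb w e p i / (observedWeight w e p i + γ) ^ 2)
      ≤ ∑ i, (p i / (observedWeight w e p i + γ)) / e := by
        refine Finset.sum_le_sum fun i _ => ?_
        have hS := observedWeight_nonneg (w := w) he hp i
        have hS' := mul_observationProb_le_observedWeight (w := w) (e := e) hp i
        rw [mul_div_assoc', div_div, div_le_div_iff₀ (by positivity) (by positivity)]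
        have h1 : observationProb w e p i * e ≤ observedWeight w e p i + γ := by linarith
        have h2 := mul_le_mul_of_nonneg_left h1
          (mul_nonneg (hp i).le (by positivity : 0 ≤ observedWeight w e p i + γ))
        linarith
    _ = (∑ i, p i / (observedWeight w e p i + γ)) / e := (Finset.sum_div _ _ _).symm
    _ ≤ (2 * independenceNumber (thresholdGraph w e) / e * Real.log (1 + 1 / γ)) / e := by
        gcongr
    _ = _ := by ring

theorem abs_convex_feedback_le {v l x R : ℝ} (hv0 : 0 ≤ v) (hv1 : v ≤ 1)
    (hl : l ∈ Set.Icc (0 : ℝ) 1) (hx : |x| ≤ R) : |v * l + (1 - v) * x| ≤ 1 + R := by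
  have h1 : |v * l| ≤ 1 := by
    rw [abs_of_nonneg (mul_nonneg hv0 hl.1)]
    exact mul_le_one₀ hv1 hl.1 hl.2
  have h2 : |(1 - v) * x| ≤ R := by
    rw [abs_mul, abs_of_nonneg (sub_nonneg.2 hv1)]
    exact (mul_le_of_le_one_left (abs_nonneg x) (by linarith)).trans hx
  exact (abs_add_le _ _).trans (add_le_add h1 h2)

theorem abs_lossEstimate_le {c : Fin N → ℝ} {K : ℝ} (he : 0 < e) (hp : ∀ i, 0 < p i) (hγ : 0 < γ)
    (a : Fin N) {i : Fin N} (hK : |c i| ≤ K) : |lossEstimate w e γ p a c i| ≤ K / γ := by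
  have hS := observedWeight_nonneg (w := w) he hp i
  have hK0 := (abs_nonneg _).trans hK
  change |_ / (observedWeight w e p i + γ)| ≤ _
  rw [abs_div, abs_of_pos (by positivity : 0 < observedWeight w e p i + γ)]
  refine div_le_div₀ hK0 ?_ hγ (by linarith)
  split_ifs
  · exact hK
  · simpa using hK0

/-- The loss estimate as a sum over the arms that may be played: each summand is the indicator of an
arm times a factor that is affine in the noise, with coefficients determined by the history. -/
theorem lossEstimate_eq {Ω : Type*} (w : Fin N → Fin N → ℝ) (e γ : ℝ) (q : Ω → Fin N → ℝ)
    (ℓ ξ : Fin N → Ω → ℝ) (I : Ω → Fin N) (ω : Ω) (i : Fin N) :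
    lossEstimate w e γ (q ω) (I ω) (fun k => w (I ω) k * ℓ k ω + (1 - w (I ω) k) * ξ k ω) i =
      ∑ j, (if I ω = j then 1 else 0) * ((if e ≤ w j i then 1 else 0) /
        (observedWeight w e (q ω) i + γ) * (w j i * ℓ i ω + (1 - w j i) * ξ i ω)) := by
  rw [Finset.sum_eq_single (I ω) (fun j _ hj => by rw [if_neg hj.symm, zero_mul])
    (fun hn => absurd (Finset.mem_univ _) hn), if_pos rfl, one_mul]
  change _ / (observedWeight w e (q ω) i + γ) = _
  split_ifs <;> ring

theorem measurable_lossEstimate {Ω : Type*} {m : MeasurableSpace Ω} {q : Ω → Fin N → ℝ}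
    {ℓ ξ : Fin N → Ω → ℝ} {I : Ω → Fin N} (hq : ∀ j, Measurable fun ω => q ω j)
    (hI : Measurable I) {i : Fin N} (hℓ : Measurable (ℓ i)) (hξ : Measurable (ξ i)) :
    Measurable fun ω => lossEstimate w e γ (q ω) (I ω)
      (fun k => w (I ω) k * ℓ k ω + (1 - w (I ω) k) * ξ k ω) i := by
  simp_rw [lossEstimate_eq]
  have hS : Measurable fun ω => observedWeight w e (q ω) i :=
    Finset.measurable_sum _ fun j _ => (hq j).mul_const _
  have hind : ∀ j, Measurable fun ω => if I ω = j then (1 : ℝ) else 0 := fun j =>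
    (measurable_of_finite fun k : Fin N => if k = j then (1 : ℝ) else 0).comp hI
  fun_prop

end Weights

namespace IsRound

variable {N : ℕ} {Ω : Type*} {m mΩ : MeasurableSpace Ω} {μ : Measure Ω} {R : ℝ}
  {q : Ω → Fin N → ℝ} {ℓ ξ : Fin N → Ω → ℝ} {I : Ω → Fin N}
  {w : Fin N → Fin N → ℝ} {e γ : ℝ}

theorem prob_le_one (h : IsRound m μ R q ℓ ξ I) (ω : Ω) (j : Fin N) : q ω j ≤ 1 := by
  rw [← h.prob_sum ω]
  exact Finset.single_le_sum (fun k _ => (h.prob_pos ω k).le) (Finset.mem_univ j)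

theorem measurable_ite_arm (h : IsRound m μ R q ℓ ξ I) (j : Fin N) :
    Measurable fun ω => if I ω = j then (1 : ℝ) else 0 :=
  (measurable_of_finite fun k : Fin N => if k = j then (1 : ℝ) else 0).comp h.arm_measurable

theorem integral_mul_ite_arm_mul_noise (h : IsRound m μ R q ℓ ξ I) {g : Ω → ℝ}
    (hg : Measurable[m] g) (i j : Fin N) :
    ∫ ω, (g ω * (if I ω = j then 1 else 0)) * ξ i ω ∂μ = 0 := by
  have hm : Measurable[m ⊔ MeasurableSpace.comap I ⊤]
      fun ω => g ω * (if I ω = j then (1 : ℝ) else 0) := by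
    have hI : Measurable[m ⊔ MeasurableSpace.comap I ⊤] I :=
      (Measurable.of_comap_le le_rfl).mono le_sup_right le_top
    exact (hg.mono le_sup_left le_rfl).mul
      ((measurable_of_finite fun k : Fin N => if k = j then (1 : ℝ) else 0).comp hI)
  have hindep : IndepFun (fun ω => g ω * (if I ω = j then (1 : ℝ) else 0)) (ξ i) μ :=
    (IndepFun_iff_Indep _ _ _).2
      (indep_of_indep_of_le_right (h.noise_indep i) hm.comap_le).symm
  rw [hindep.integral_fun_mul_eq_mul_integral
    ((hg.mono h.le le_rfl).mul (h.measurable_ite_arm j)).aestronglyMeasurable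
    (h.noise_measurable i).aestronglyMeasurable, h.noise_mean i, mul_zero]

theorem measurable_observedWeight (h : IsRound m μ R q ℓ ξ I) (w : Fin N → Fin N → ℝ) (e : ℝ)
    (i : Fin N) : Measurable[m] fun ω => observedWeight w e (q ω) i :=
  Finset.measurable_sum _ fun j _ => (h.prob_measurable j).mul_const _

theorem measurable_observationProb (h : IsRound m μ R q ℓ ξ I) (w : Fin N → Fin N → ℝ) (e : ℝ)
    (i : Fin N) : Measurable[m] fun ω => observationProb w e (q ω) i :=
  Finset.measurable_sum _ fun j _ => by
    split_ifs
    · exact h.prob_measurable j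
    · exact measurable_const

theorem observationProb_le_one (h : IsRound m μ R q ℓ ξ I) (ω : Ω) (i : Fin N) :
    observationProb w e (q ω) i ≤ 1 := by
  rw [← h.prob_sum ω]
  refine Finset.sum_le_sum fun j _ => ?_
  split_ifs <;> [exact le_rfl; exact (h.prob_pos ω j).le]

theorem measurable_lossEstimate (h : IsRound m μ R q ℓ ξ I) (i : Fin N) :
    Measurable fun ω => lossEstimate w e γ (q ω) (I ω)
      (fun k => w (I ω) k * ℓ k ω + (1 - w (I ω) k) * ξ k ω) i :=
  _root_.measurable_lossEstimate (fun j => (h.prob_measurable j).mono h.le le_rfl)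
    h.arm_measurable ((h.loss_measurable i).mono h.le le_rfl) (h.noise_measurable i)

theorem ae_abs_lossEstimate_le (h : IsRound m μ R q ℓ ξ I) (he : 0 < e) (hγ : 0 < γ)
    (hw0 : ∀ i j, 0 ≤ w i j) (hw1 : ∀ i j, w i j ≤ 1) (i : Fin N) :
    ∀ᵐ ω ∂μ, |lossEstimate w e γ (q ω) (I ω)
      (fun k => w (I ω) k * ℓ k ω + (1 - w (I ω) k) * ξ k ω) i| ≤ (1 + R) / γ := by
  filter_upwards [h.noise_bounded i] with ω hω
  exact abs_lossEstimate_le he (h.prob_pos ω) hγ _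
    (abs_convex_feedback_le (hw0 _ _) (hw1 _ _) (h.loss_mem i ω) hω)

theorem abs_div_observedWeight_le (h : IsRound m μ R q ℓ ξ I) (he : 0 < e) (hγ : 0 < γ) (ω : Ω)
    (i : Fin N) {x K : ℝ} (hx : |x| ≤ K) :
    |x / (observedWeight w e (q ω) i + γ)| ≤ K / γ := by
  have hS := observedWeight_nonneg (w := w) he (h.prob_pos ω) i
  rw [abs_div, abs_of_pos (by positivity : 0 < observedWeight w e (q ω) i + γ)]
  exact div_le_div₀ ((abs_nonneg _).trans hx) hx hγ (by linarith)

variable [IsProbabilityMeasure μ]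

theorem integral_mul_ite_arm (h : IsRound m μ R q ℓ ξ I) {g : Ω → ℝ} (hg : Measurable[m] g) {c : ℝ}
    (hgc : ∀ ω, |g ω| ≤ c) (j : Fin N) :
    ∫ ω, g ω * (if I ω = j then 1 else 0) ∂μ = ∫ ω, g ω * q ω j ∂μ := by
  have hind : (fun ω => if I ω = j then (1 : ℝ) else 0) =
      Set.indicator {ω | I ω = j} (fun _ => (1 : ℝ)) := by
    ext ω
    simp [Set.indicator_apply]
  have hint : Integrable (fun ω => if I ω = j then (1 : ℝ) else 0) μ :=
    Integrable.of_bound (h.measurable_ite_arm j).aestronglyMeasurable 1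
      (Filter.Eventually.of_forall fun ω => by split_ifs <;> simp)
  have h1 := condExp_stronglyMeasurable_mul_of_bound h.le hg.stronglyMeasurable hint c
    (Filter.Eventually.of_forall hgc)
  have h2 := integral_condExp (μ := μ) (f := g * fun ω => if I ω = j then (1 : ℝ) else 0) h.le
  calc ∫ ω, g ω * (if I ω = j then 1 else 0) ∂μ
      = ∫ ω, (μ[g * fun ω => if I ω = j then (1 : ℝ) else 0 | m]) ω ∂μ := h2.symm
    _ = ∫ ω, g ω * q ω j ∂μ := by
        refine integral_congr_ae ?_
        have h3 := h.law j
        rw [← hind] at h3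
        filter_upwards [h1, h3] with ω hω hω'
        rw [hω, Pi.mul_apply, hω']

/-- The conditional mean of the loss estimate, tested against a function `g` of the history: the
noise averages out, and implicit exploration biases the estimate downwards. -/
theorem integral_mul_lossEstimate (h : IsRound m μ R q ℓ ξ I) (he : 0 < e) (hγ : 0 < γ)
    {g : Ω → ℝ} (hg : Measurable[m] g) {c : ℝ} (hgc : ∀ ω, |g ω| ≤ c) (i : Fin N) :
    ∫ ω, g ω * lossEstimate w e γ (q ω) (I ω)
      (fun k => w (I ω) k * ℓ k ω + (1 - w (I ω) k) * ξ k ω) i ∂μ =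
    ∫ ω, g ω * (ℓ i ω * observedWeight w e (q ω) i / (observedWeight w e (q ω) i + γ)) ∂μ := by
  set a : Fin N → ℝ := fun j => if e ≤ w j i then 1 else 0 with ha
  set G : Ω → ℝ := fun ω => g ω / (observedWeight w e (q ω) i + γ) with hG
  have hSm := h.measurable_observedWeight w e i
  have hGm : Measurable[m] G := hg.div (hSm.add_const γ)
  have hGb : ∀ ω, |G ω| ≤ c / γ := fun ω => h.abs_div_observedWeight_le he hγ ω i (hgc ω)
  have hGlm : Measurable[m] fun ω => G ω * ℓ i ω := hGm.mul (h.loss_measurable i)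
  have hGlb : ∀ ω, |G ω * ℓ i ω| ≤ c / γ := fun ω => by
    have hl := h.loss_mem i ω
    rw [abs_mul, abs_of_nonneg hl.1]
    exact (mul_le_of_le_one_right (abs_nonneg _) hl.2).trans (hGb ω)
  have hGli : ∀ j, Integrable (fun ω => (G ω * ℓ i ω) * (if I ω = j then 1 else 0)) μ := fun j =>
    Integrable.of_bound ((hGlm.mono h.le le_rfl).mul
      (h.measurable_ite_arm j)).aestronglyMeasurable (c / γ)
      (Filter.Eventually.of_forall fun ω => by
        rw [Real.norm_eq_abs, abs_mul]
        refine (mul_le_of_le_one_right (abs_nonneg _) ?_).trans (hGlb ω)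
        split_ifs <;> simp)
  have hGlq : ∀ j, Integrable (fun ω => (G ω * ℓ i ω) * q ω j) μ := fun j =>
    Integrable.of_bound ((hGlm.mul (h.prob_measurable j)).mono h.le le_rfl).aestronglyMeasurable
      (c / γ) (Filter.Eventually.of_forall fun ω => by
        rw [Real.norm_eq_abs, abs_mul, abs_of_pos (h.prob_pos ω j)]
        exact (mul_le_of_le_one_right (abs_nonneg _) (h.prob_le_one ω j)).trans (hGlb ω))
  have hGxi : ∀ j, Integrable (fun ω => (G ω * (if I ω = j then 1 else 0)) * ξ i ω) μ := fun j =>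
    Integrable.of_bound (((hGm.mono h.le le_rfl).mul (h.measurable_ite_arm j)).mul
      (h.noise_measurable i)).aestronglyMeasurable (c / γ * R) (by
        filter_upwards [h.noise_bounded i] with ω hω
        rw [Real.norm_eq_abs, abs_mul, abs_mul]
        refine mul_le_mul ?_ hω (abs_nonneg _) ((abs_nonneg _).trans (hGb ω))
        refine (mul_le_of_le_one_right (abs_nonneg _) ?_).trans (hGb ω)
        split_ifs <;> simp)
  calc ∫ ω, g ω * lossEstimate w e γ (q ω) (I ω)
        (fun k => w (I ω) k * ℓ k ω + (1 - w (I ω) k) * ξ k ω) i ∂μ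
      = ∫ ω, ∑ j, ((a j * w j i) * ((G ω * ℓ i ω) * (if I ω = j then 1 else 0)) +
          (a j * (1 - w j i)) * ((G ω * (if I ω = j then 1 else 0)) * ξ i ω)) ∂μ := by
        refine integral_congr_ae (Filter.Eventually.of_forall fun ω => ?_)
        simp only [lossEstimate_eq, Finset.mul_sum]
        refine Finset.sum_congr rfl fun j _ => ?_
        simp only [hG, ha]
        ring
    _ = ∑ j, ((a j * w j i) * ∫ ω, (G ω * ℓ i ω) * q ω j ∂μ) := by
        rw [integral_finsetSum]
        swap
        · exact fun j _ => ((hGli j).const_mul _).add ((hGxi j).const_mul _)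
        refine Finset.sum_congr rfl fun j _ => ?_
        rw [integral_add ((hGli j).const_mul _) ((hGxi j).const_mul _), integral_const_mul,
          integral_const_mul, h.integral_mul_ite_arm hGlm hGlb j,
          h.integral_mul_ite_arm_mul_noise hGm i j, mul_zero, add_zero]
    _ = ∫ ω, ∑ j, (a j * w j i) * ((G ω * ℓ i ω) * q ω j) ∂μ := by
        rw [integral_finsetSum _ fun j _ => (hGlq j).const_mul _]
        simp_rw [integral_const_mul]
    _ = _ := by
        refine integral_congr_ae (Filter.Eventually.of_forall fun ω => ?_)
        have hS : observedWeight w e (q ω) i = ∑ j, (a j * w j i) * q ω j := by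
          rw [observedWeight]
          refine Finset.sum_congr rfl fun j _ => ?_
          simp only [truncatedWeight, ha]
          split_ifs <;> ring
        simp only [hG]
        nth_rewrite 2 [hS]
        rw [Finset.mul_sum, Finset.sum_div, Finset.mul_sum]
        exact Finset.sum_congr rfl fun j _ => by ring

/-- The conditional second moment of the loss estimate, tested against the probability of the
arm. -/
theorem integral_mul_lossEstimate_sq_le (h : IsRound m μ R q ℓ ξ I) (he : 0 < e) (hγ : 0 < γ)
    (hw0 : ∀ i j, 0 ≤ w i j) (hw1 : ∀ i j, w i j ≤ 1) (i : Fin N) :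
    ∫ ω, q ω i * lossEstimate w e γ (q ω) (I ω)
      (fun k => w (I ω) k * ℓ k ω + (1 - w (I ω) k) * ξ k ω) i ^ 2 ∂μ ≤
    (1 + R) ^ 2 * ∫ ω, q ω i * (observationProb w e (q ω) i /
      (observedWeight w e (q ω) i + γ) ^ 2) ∂μ := by
  set a : Fin N → ℝ := fun j => if e ≤ w j i then 1 else 0 with ha
  set G : Ω → ℝ := fun ω => q ω i / (observedWeight w e (q ω) i + γ) /
    (observedWeight w e (q ω) i + γ) with hG
  have hSm := (h.measurable_observedWeight w e i).add_const γ
  have hGm : Measurable[m] G := ((h.prob_measurable i).div hSm).div hSm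
  have hGb : ∀ ω, |G ω| ≤ 1 / γ / γ := fun ω =>
    h.abs_div_observedWeight_le he hγ ω i <| h.abs_div_observedWeight_le he hγ ω i <| by
      rw [abs_of_pos (h.prob_pos ω i)]
      exact h.prob_le_one ω i
  have hG0 : ∀ ω, 0 ≤ G ω := fun ω => by
    have hS := observedWeight_nonneg (w := w) he (h.prob_pos ω) i
    have := (h.prob_pos ω i).le
    simp only [hG]
    positivity
  have hGi : ∀ j, Integrable (fun ω => G ω * (if I ω = j then 1 else 0)) μ := fun j =>
    Integrable.of_bound ((hGm.mono h.le le_rfl).mul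
      (h.measurable_ite_arm j)).aestronglyMeasurable (1 / γ / γ)
      (Filter.Eventually.of_forall fun ω => by
        rw [Real.norm_eq_abs, abs_mul]
        refine (mul_le_of_le_one_right (abs_nonneg _) ?_).trans (hGb ω)
        split_ifs <;> simp)
  have hGq : ∀ j, Integrable (fun ω => G ω * q ω j) μ := fun j =>
    Integrable.of_bound ((hGm.mul (h.prob_measurable j)).mono h.le le_rfl).aestronglyMeasurable
      (1 / γ / γ) (Filter.Eventually.of_forall fun ω => by
        rw [Real.norm_eq_abs, abs_mul, abs_of_pos (h.prob_pos ω j)]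
        exact (mul_le_of_le_one_right (abs_nonneg _) (h.prob_le_one ω j)).trans (hGb ω))
  calc ∫ ω, q ω i * lossEstimate w e γ (q ω) (I ω)
        (fun k => w (I ω) k * ℓ k ω + (1 - w (I ω) k) * ξ k ω) i ^ 2 ∂μ
      ≤ ∫ ω, ∑ j, ((1 + R) ^ 2 * a j) * (G ω * (if I ω = j then 1 else 0)) ∂μ := by
        refine integral_mono_of_nonneg (Filter.Eventually.of_forall fun ω =>
          mul_nonneg (h.prob_pos ω i).le (sq_nonneg _))
          (integrable_finsetSum _ fun j _ => (hGi j).const_mul _) ?_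
        filter_upwards [h.noise_bounded i] with ω hω
        rw [Finset.sum_eq_single (I ω)
          (fun j _ hj => by rw [if_neg hj.symm, mul_zero, mul_zero])
          (fun hn => absurd (Finset.mem_univ _) hn), if_pos rfl, mul_one]
        have hc := abs_convex_feedback_le (hw0 (I ω) i) (hw1 (I ω) i) (h.loss_mem i ω) hω
        have hc2 := sq_le_sq' (abs_le.1 hc).1 (abs_le.1 hc).2
        change q ω i * (_ / (observedWeight w e (q ω) i + γ)) ^ 2 ≤ _
        simp only [ha]
        split_ifs
        · have := mul_le_mul_of_nonneg_right hc2 (hG0 ω)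
          simp only [mul_one]
          refine le_of_eq_of_le ?_ this
          simp only [hG]
          ring
        · simp
    _ = ∑ j, ((1 + R) ^ 2 * a j) * ∫ ω, G ω * q ω j ∂μ := by
        rw [integral_finsetSum _ fun j _ => (hGi j).const_mul _]
        refine Finset.sum_congr rfl fun j _ => ?_
        rw [integral_const_mul, h.integral_mul_ite_arm hGm hGb j]
    _ = ∫ ω, ∑ j, ((1 + R) ^ 2 * a j) * (G ω * q ω j) ∂μ := by
        rw [integral_finsetSum _ fun j _ => (hGq j).const_mul _]
        simp_rw [integral_const_mul]
    _ = ∫ ω, (1 + R) ^ 2 * (q ω i * (observationProb w e (q ω) i /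
          (observedWeight w e (q ω) i + γ) ^ 2)) ∂μ := by
        refine integral_congr_ae (Filter.Eventually.of_forall fun ω => ?_)
        have hP : observationProb w e (q ω) i = ∑ j, a j * q ω j := by
          rw [observationProb]
          refine Finset.sum_congr rfl fun j _ => ?_
          simp only [ha]
          split_ifs <;> simp
        simp only [hP, hG]
        rw [Finset.sum_div, Finset.mul_sum, Finset.mul_sum]
        refine Finset.sum_congr rfl fun j _ => ?_
        rw [div_div, ← sq]
        ring
    _ = _ := integral_const_mul _ _

theorem integral_loss_arm (h : IsRound m μ R q ℓ ξ I) :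
    ∫ ω, ℓ (I ω) ω ∂μ = ∫ ω, ∑ j, ℓ j ω * q ω j ∂μ := by
  have hb : ∀ j ω, |ℓ j ω| ≤ 1 := fun j ω => by
    rw [abs_of_nonneg (h.loss_mem j ω).1]
    exact (h.loss_mem j ω).2
  have hi : ∀ j, Integrable (ℓ j) μ := fun j =>
    Integrable.of_bound ((h.loss_measurable j).mono h.le le_rfl).aestronglyMeasurable 1
      (Filter.Eventually.of_forall (hb j))
  have h1 : ∀ j, Integrable (fun ω => ℓ j ω * (if I ω = j then 1 else 0)) μ := fun j =>
    (hi j).mul_bdd (c := 1) (h.measurable_ite_arm j).aestronglyMeasurable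
      (Filter.Eventually.of_forall fun ω => by split_ifs <;> simp)
  have h2 : ∀ j, Integrable (fun ω => ℓ j ω * q ω j) μ := fun j =>
    (hi j).mul_bdd (c := 1) ((h.prob_measurable j).mono h.le le_rfl).aestronglyMeasurable
      (Filter.Eventually.of_forall fun ω => by
        rw [Real.norm_eq_abs, abs_of_pos (h.prob_pos ω j)]
        exact h.prob_le_one ω j)
  calc ∫ ω, ℓ (I ω) ω ∂μ = ∫ ω, ∑ j, ℓ j ω * (if I ω = j then 1 else 0) ∂μ := by simp
    _ = ∫ ω, ∑ j, ℓ j ω * q ω j ∂μ := by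
      rw [integral_finsetSum _ fun j _ => h1 j, integral_finsetSum _ fun j _ => h2 j]
      exact Finset.sum_congr rfl fun j _ => h.integral_mul_ite_arm (h.loss_measurable j) (hb j) j

end IsRound

/-! ### The regret in a single round -/

namespace IsRound

variable {N : ℕ} {Ω : Type*} {m mΩ : MeasurableSpace Ω} {μ : Measure Ω} {R : ℝ}
  {q : Ω → Fin N → ℝ} {ℓ ξ : Fin N → Ω → ℝ} {I : Ω → Fin N} {w : Fin N → Fin N → ℝ} {e γ : ℝ}
  [IsProbabilityMeasure μ]

theorem integrable_mul_lossEstimate (h : IsRound m μ R q ℓ ξ I) (he : 0 < e) (hγ : 0 < γ)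
    (hw0 : ∀ i j, 0 ≤ w i j) (hw1 : ∀ i j, w i j ≤ 1) (i : Fin N) :
    Integrable (fun ω => q ω i * lossEstimate w e γ (q ω) (I ω)
      (fun k => w (I ω) k * ℓ k ω + (1 - w (I ω) k) * ξ k ω) i) μ := by
  refine Integrable.of_bound (((h.prob_measurable i).mono h.le le_rfl).mul
    (h.measurable_lossEstimate i)).aestronglyMeasurable ((1 + R) / γ) ?_
  filter_upwards [h.ae_abs_lossEstimate_le he hγ hw0 hw1 i] with ω hω
  rw [Real.norm_eq_abs, abs_mul, abs_of_pos (h.prob_pos ω i)]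
  exact (mul_le_of_le_one_left (abs_nonneg _) (h.prob_le_one ω i)).trans hω

theorem integrable_lossEstimate (h : IsRound m μ R q ℓ ξ I) (he : 0 < e) (hγ : 0 < γ)
    (hw0 : ∀ i j, 0 ≤ w i j) (hw1 : ∀ i j, w i j ≤ 1) (i : Fin N) :
    Integrable (fun ω => lossEstimate w e γ (q ω) (I ω)
      (fun k => w (I ω) k * ℓ k ω + (1 - w (I ω) k) * ξ k ω) i) μ :=
  Integrable.of_bound (h.measurable_lossEstimate i).aestronglyMeasurable ((1 + R) / γ)
    (h.ae_abs_lossEstimate_le he hγ hw0 hw1 i)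

theorem integrable_mul_lossEstimate_sq (h : IsRound m μ R q ℓ ξ I) (he : 0 < e) (hγ : 0 < γ)
    (hw0 : ∀ i j, 0 ≤ w i j) (hw1 : ∀ i j, w i j ≤ 1) (i : Fin N) :
    Integrable (fun ω => q ω i * lossEstimate w e γ (q ω) (I ω)
      (fun k => w (I ω) k * ℓ k ω + (1 - w (I ω) k) * ξ k ω) i ^ 2) μ := by
  refine Integrable.of_bound (((h.prob_measurable i).mono h.le le_rfl).mul
    ((h.measurable_lossEstimate i).pow_const 2)).aestronglyMeasurable (((1 + R) / γ) ^ 2) ?_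
  filter_upwards [h.ae_abs_lossEstimate_le he hγ hw0 hw1 i] with ω hω
  rw [Real.norm_eq_abs, abs_mul, abs_of_pos (h.prob_pos ω i), abs_pow]
  exact (mul_le_of_le_one_left (by positivity) (h.prob_le_one ω i)).trans
    (pow_le_pow_left₀ (abs_nonneg _) hω 2)

theorem integrable_loss (h : IsRound m μ R q ℓ ξ I) (i : Fin N) : Integrable (ℓ i) μ :=
  Integrable.of_bound ((h.loss_measurable i).mono h.le le_rfl).aestronglyMeasurable 1
    (Filter.Eventually.of_forall fun ω => by
      rw [Real.norm_eq_abs, abs_of_nonneg (h.loss_mem i ω).1]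
      exact (h.loss_mem i ω).2)

theorem integrable_loss_arm (h : IsRound m μ R q ℓ ξ I) :
    Integrable (fun ω => ℓ (I ω) ω) μ := by
  have heq : (fun ω => ℓ (I ω) ω) = fun ω => ∑ j, ℓ j ω * (if I ω = j then 1 else 0) := by
    ext ω
    simp
  rw [heq]
  exact integrable_finsetSum _ fun j _ => (h.integrable_loss j).mul_bdd (c := 1)
    (h.measurable_ite_arm j).aestronglyMeasurable
    (Filter.Eventually.of_forall fun ω => by split_ifs <;> simp)

/-- The expected regret of a round exceeds the regret with respect to the loss estimates by at most
the bias that implicit exploration causes. -/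
theorem integral_regret_le (h : IsRound m μ R q ℓ ξ I) (he : 0 < e) (hγ : 0 < γ)
    (hw0 : ∀ i j, 0 ≤ w i j) (hw1 : ∀ i j, w i j ≤ 1) {B : ℝ}
    (hB : ∀ ω, ∑ j, q ω j / (observedWeight w e (q ω) j + γ) ≤ B) (i : Fin N) :
    ∫ ω, (ℓ (I ω) ω - ℓ i ω) ∂μ ≤
      ∫ ω, ((∑ j, q ω j * lossEstimate w e γ (q ω) (I ω)
        (fun k => w (I ω) k * ℓ k ω + (1 - w (I ω) k) * ξ k ω) j) -
        lossEstimate w e γ (q ω) (I ω)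
          (fun k => w (I ω) k * ℓ k ω + (1 - w (I ω) k) * ξ k ω) i) ∂μ + γ * B := by
  set F : Fin N → Ω → ℝ := fun j ω =>
    ℓ j ω * observedWeight w e (q ω) j / (observedWeight w e (q ω) j + γ) with hF
  have hS : ∀ j ω, 0 ≤ observedWeight w e (q ω) j := fun j ω =>
    observedWeight_nonneg he (h.prob_pos ω) j
  have hFm : ∀ j, Measurable (F j) := fun j =>
    (((h.loss_measurable j).mul (h.measurable_observedWeight w e j)).div
      ((h.measurable_observedWeight w e j).add_const γ)).mono h.le le_rfl
  have hFeq : ∀ j ω, F j ω = ℓ j ω - γ * (ℓ j ω / (observedWeight w e (q ω) j + γ)) := by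
    intro j ω
    have := hS j ω
    have : observedWeight w e (q ω) j + γ ≠ 0 := by positivity
    simp only [hF]
    field_simp
    ring
  have hF0 : ∀ j ω, 0 ≤ F j ω := fun j ω => by
    have := hS j ω
    have := (h.loss_mem j ω).1
    positivity
  have hFle : ∀ j ω, F j ω ≤ ℓ j ω := fun j ω => by
    rw [hFeq]
    have := hS j ω
    have := (h.loss_mem j ω).1
    have : 0 ≤ γ * (ℓ j ω / (observedWeight w e (q ω) j + γ)) := by positivity
    linarith
  have hFint : ∀ j, Integrable (F j) μ := fun j =>
    (h.integrable_loss j).mono' (hFm j).aestronglyMeasurable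
      (Filter.Eventually.of_forall fun ω => by
        rw [Real.norm_eq_abs, abs_of_nonneg (hF0 j ω)]
        exact hFle j ω)
  have hqb : ∀ j, ∀ᵐ ω ∂μ, ‖q ω j‖ ≤ 1 := fun j => Filter.Eventually.of_forall fun ω => by
    rw [Real.norm_eq_abs, abs_of_pos (h.prob_pos ω j)]
    exact h.prob_le_one ω j
  have hqm : ∀ j, AEStronglyMeasurable (fun ω => q ω j) μ := fun j =>
    ((h.prob_measurable j).mono h.le le_rfl).aestronglyMeasurable
  have hqF : ∀ j, Integrable (fun ω => q ω j * F j ω) μ := fun j =>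
    (hFint j).bdd_mul (hqm j) (hqb j)
  have hℓq : ∀ j, Integrable (fun ω => ℓ j ω * q ω j) μ := fun j =>
    (h.integrable_loss j).mul_bdd (hqm j) (hqb j)
  have h1 : ∫ ω, (∑ j, q ω j * lossEstimate w e γ (q ω) (I ω)
      (fun k => w (I ω) k * ℓ k ω + (1 - w (I ω) k) * ξ k ω) j) ∂μ =
      ∫ ω, ∑ j, q ω j * F j ω ∂μ := by
    rw [integral_finsetSum _ fun j _ => h.integrable_mul_lossEstimate he hγ hw0 hw1 j,
      integral_finsetSum _ fun j _ => hqF j]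
    exact Finset.sum_congr rfl fun j _ => h.integral_mul_lossEstimate he hγ (h.prob_measurable j)
      (c := 1) (fun ω => by
        rw [abs_of_pos (h.prob_pos ω j)]
        exact h.prob_le_one ω j) j
  have h2 : ∫ ω, lossEstimate w e γ (q ω) (I ω)
      (fun k => w (I ω) k * ℓ k ω + (1 - w (I ω) k) * ξ k ω) i ∂μ ≤ ∫ ω, ℓ i ω ∂μ := by
    have := h.integral_mul_lossEstimate (w := w) he hγ (g := fun _ => 1) measurable_const (c := 1)
      (fun _ => by simp) i
    simp only [one_mul] at this
    rw [this]
    exact integral_mono (hFint i) (h.integrable_loss i) (hFle i)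
  have h3 : ∫ ω, ∑ j, ℓ j ω * q ω j ∂μ ≤ ∫ ω, ((∑ j, q ω j * F j ω) + γ * B) ∂μ := by
    refine integral_mono (integrable_finsetSum _ fun j _ => hℓq j)
      ((integrable_finsetSum _ fun j _ => hqF j).add (integrable_const _)) fun ω => ?_
    have hsum : ∑ j, ℓ j ω * q ω j ≤
        (∑ j, q ω j * F j ω) + γ * ∑ j, q ω j / (observedWeight w e (q ω) j + γ) := by
      rw [Finset.mul_sum, ← Finset.sum_add_distrib]
      refine Finset.sum_le_sum fun j _ => ?_
      have hSj := hS j ω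
      have hqj := (h.prob_pos ω j).le
      have hle : γ * (q ω j * (ℓ j ω / (observedWeight w e (q ω) j + γ))) ≤
          γ * (q ω j / (observedWeight w e (q ω) j + γ)) := by
        rw [← mul_div_assoc (q ω j)]
        gcongr
        exact mul_le_of_le_one_right hqj (h.loss_mem j ω).2
      rw [hFeq]
      linarith
    exact hsum.trans (by gcongr; exact hB ω)
  rw [integral_add (integrable_finsetSum _ fun j _ => hqF j) (integrable_const _),
    integral_const, probReal_univ, one_smul] at h3
  rw [integral_sub h.integrable_loss_arm (h.integrable_loss i), h.integral_loss_arm,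
    integral_sub (integrable_finsetSum _ fun j _ => h.integrable_mul_lossEstimate he hγ hw0 hw1 j)
      (h.integrable_lossEstimate he hγ hw0 hw1 i), h1]
  linarith

theorem integral_sum_mul_lossEstimate_sq_le (h : IsRound m μ R q ℓ ξ I) (he : 0 < e) (hγ : 0 < γ)
    (hw0 : ∀ i j, 0 ≤ w i j) (hw1 : ∀ i j, w i j ≤ 1) {B : ℝ}
    (hB : ∀ ω, ∑ j, q ω j * (observationProb w e (q ω) j /
      (observedWeight w e (q ω) j + γ) ^ 2) ≤ B) :
    ∫ ω, ∑ j, q ω j * lossEstimate w e γ (q ω) (I ω)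
      (fun k => w (I ω) k * ℓ k ω + (1 - w (I ω) k) * ξ k ω) j ^ 2 ∂μ ≤ (1 + R) ^ 2 * B := by
  have hint : ∀ j, Integrable (fun ω => q ω j * (observationProb w e (q ω) j /
      (observedWeight w e (q ω) j + γ) ^ 2)) μ := fun j => by
    refine Integrable.of_bound (((h.prob_measurable j).mul
      ((h.measurable_observationProb w e j).div
        (((h.measurable_observedWeight w e j).add_const γ).pow_const 2))).mono
          h.le le_rfl).aestronglyMeasurable (1 / γ ^ 2) (Filter.Eventually.of_forall fun ω => ?_)
    have hS := observedWeight_nonneg (w := w) he (h.prob_pos ω) j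
    have hP := observationProb_nonneg (w := w) (e := e) (h.prob_pos ω) j
    have hq := h.prob_pos ω j
    rw [Real.norm_eq_abs, abs_of_nonneg (by positivity)]
    refine (mul_le_of_le_one_left (by positivity) (h.prob_le_one ω j)).trans ?_
    have := h.observationProb_le_one (w := w) (e := e) ω j
    gcongr
    linarith
  rw [integral_finsetSum _ fun j _ => h.integrable_mul_lossEstimate_sq he hγ hw0 hw1 j]
  refine (Finset.sum_le_sum fun j _ =>
    h.integral_mul_lossEstimate_sq_le he hγ hw0 hw1 j).trans ?_
  rw [← Finset.mul_sum, ← integral_finsetSum _ fun j _ => hint j]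
  refine mul_le_mul_of_nonneg_left ?_ (sq_nonneg _)
  refine (integral_mono (integrable_finsetSum _ fun j _ => hint j) (integrable_const B) hB).trans ?_
  simp

end IsRound

/-! ### The regret of Exp3-IXt -/

section Regret

variable {N T : ℕ} {Ω : Type*} {mΩ : MeasurableSpace Ω} {μ : Measure Ω} {R : ℝ}
  {s : ℕ → Fin N → Fin N → ℝ} {ε η γ : ℕ → ℝ} {𝓕 : Filtration ℕ mΩ} {ℓ ξ : ℕ → Fin N → Ω → ℝ}
  {I : ℕ → Ω → Fin N}

theorem measurable_expWeights {m : MeasurableSpace Ω} {L : Ω → Fin N → ℝ} (η : ℝ)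
    (hL : ∀ i, Measurable fun ω => L ω i) (i : Fin N) :
    Measurable fun ω => expWeights η (L ω) i := by
  unfold expWeights
  fun_prop

theorem measurable_cumulativeEstimate (henv : IsNoisyEnvironment μ T R 𝓕 ℓ ξ I)
    (hI : ∀ t < T, Measurable[𝓕 (t + 1)] (I t)) {t : ℕ} (ht : t ≤ T) (i : Fin N) :
    Measurable[𝓕 t] fun ω => cumulativeEstimate s ε η γ (fun r => I r ω)
      (feedback s (fun r j => ℓ r j ω) (fun r j => ξ r j ω) (fun r => I r ω)) t i := by
  induction t generalizing i with
  | zero => exact measurable_const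
  | succ t ih =>
    have hle : 𝓕 t ≤ 𝓕 (t + 1) := 𝓕.mono (Nat.le_succ t)
    have hL : ∀ j, Measurable[𝓕 (t + 1)] fun ω => cumulativeEstimate s ε η γ (fun r => I r ω)
        (feedback s (fun r j => ℓ r j ω) (fun r j => ξ r j ω) (fun r => I r ω)) t j :=
      fun j => (ih (by omega) j).mono hle le_rfl
    exact (hL i).add (measurable_lossEstimate (measurable_expWeights (η t) hL) (hI t ht)
      ((henv.loss_measurable t ht i).mono hle le_rfl) (henv.noise_measurable t ht i))

theorem IsExp3IXt.isRound (hN : 1 ≤ N) (henv : IsNoisyEnvironment μ T R 𝓕 ℓ ξ I)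
    (halg : IsExp3IXt μ T s ε η γ 𝓕 ℓ ξ I) {t : ℕ} (ht : t < T) :
    IsRound (𝓕 t) μ R (fun ω => playDistribution s ε η γ (fun r => I r ω)
      (feedback s (fun r j => ℓ r j ω) (fun r j => ξ r j ω) (fun r => I r ω)) t)
      (ℓ t) (ξ t) (I t) where
  le := 𝓕.le t
  law := halg.arm_law t ht
  prob_measurable := measurable_expWeights (η t)
    (measurable_cumulativeEstimate henv halg.arm_measurable ht.le)
  prob_pos _ _ := expWeights_pos _ _ _
  prob_sum _ := sum_expWeights hN _ _
  arm_measurable := (halg.arm_measurable t ht).mono (𝓕.le _) le_rfl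
  loss_measurable := henv.loss_measurable t ht
  loss_mem := henv.loss_mem t ht
  noise_measurable i := (henv.noise_measurable t ht i).mono (𝓕.le _) le_rfl
  noise_bounded := henv.noise_bounded t ht
  noise_mean := henv.noise_mean t ht
  noise_indep i := indep_of_indep_of_le_right (henv.noise_indep t ht i) le_sup_left

theorem expectedRegret_le_card_rounds [IsProbabilityMeasure μ] (hN : 1 ≤ N)
    (henv : IsNoisyEnvironment μ T R 𝓕 ℓ ξ I) : expectedRegret μ T ℓ I ≤ T := by
  have : Nonempty (Fin N) := ⟨⟨0, hN⟩⟩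
  refine ciSup_le fun i => (le_abs_self _).trans ?_
  have h := norm_integral_le_of_norm_le_const (μ := μ) (C := T)
    (f := fun ω => (∑ t ∈ Finset.range T, ℓ t (I t ω) ω) - ∑ t ∈ Finset.range T, ℓ t i ω)
    (Filter.Eventually.of_forall fun ω => by
      rw [← Finset.sum_sub_distrib]
      refine (norm_sum_le _ _).trans ?_
      refine (Finset.sum_le_card_nsmul _ _ 1 fun t ht => ?_).trans_eq (by simp)
      have h1 := henv.loss_mem t (Finset.mem_range.1 ht) (I t ω) ω
      have h2 := henv.loss_mem t (Finset.mem_range.1 ht) i ω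
      exact abs_le.2 ⟨by linarith [h1.1, h2.2], by linarith [h1.2, h2.1]⟩)
  simpa using h

/-- The regret bound for given parameters. The condition `η (1 + R) ≤ γ` makes the estimates small
enough for the second-order analysis of exponential weights. -/
theorem expectedRegret_le [IsProbabilityMeasure μ] (hN : 1 ≤ N)
    (hs : IsObservationGraphs T s) (hε : ∀ t < T, ε t ∈ Set.Ioc (0 : ℝ) 1) {η γ : ℝ} (hη : 0 < η)
    (hγ : 0 < γ) (hηγ : η * (1 + R) ≤ γ) (henv : IsNoisyEnvironment μ T R 𝓕 ℓ ξ I)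
    (halg : IsExp3IXt μ T s ε (fun _ => η) (fun _ => γ) 𝓕 ℓ ξ I) :
    expectedRegret μ T ℓ I ≤ Real.log N / η + (η * (1 + R) ^ 2 + γ) *
      (2 * Real.log (1 + 1 / γ) * ∑ t ∈ Finset.range T,
        (independenceNumber (thresholdGraph (s t) (ε t)) : ℝ) / ε t ^ 2) := by
  have : Nonempty (Fin N) := ⟨⟨0, hN⟩⟩
  refine ciSup_le fun i => ?_
  set L : ℕ → Ω → Fin N → ℝ := fun t ω =>
    cumulativeEstimate s ε (fun _ => η) (fun _ => γ) (fun r => I r ω)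
      (feedback s (fun r j => ℓ r j ω) (fun r j => ξ r j ω) (fun r => I r ω)) t with hL
  set q : ℕ → Ω → Fin N → ℝ := fun t ω => expWeights η (L t ω) with hq
  set X : ℕ → Ω → Fin N → ℝ := fun t ω => lossEstimate (s t) (ε t) γ (q t ω) (I t ω)
    (fun k => s t (I t ω) k * ℓ t k ω + (1 - s t (I t ω) k) * ξ t k ω) with hX
  set B : ℕ → ℝ := fun t => 2 * ((independenceNumber (thresholdGraph (s t) (ε t)) : ℝ) / ε t ^ 2) *
    Real.log (1 + 1 / γ) with hB
  have hround : ∀ t < T, IsRound (𝓕 t) μ R (q t) (ℓ t) (ξ t) (I t) := fun t ht =>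
    halg.isRound hN henv ht
  have hlog : 0 ≤ Real.log (1 + 1 / γ) := Real.log_nonneg (by
    have : 0 < 1 / γ := by positivity
    linarith)
  have hregret : ∀ t < T, ∫ ω, (ℓ t (I t ω) ω - ℓ t i ω) ∂μ ≤
      ∫ ω, ((∑ j, q t ω j * X t ω j) - X t ω i) ∂μ + γ * B t := fun t ht => by
    refine (hround t ht).integral_regret_le (hε t ht).1 hγ (hs.nonneg t ht) (hs.le_one t ht)
      (fun ω => ?_) i
    refine (sum_div_observedWeight_le hN (hε t ht).1 (hε t ht).2 (hs.self_eq_one t ht)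
      ((hround t ht).prob_pos ω) ((hround t ht).prob_sum ω) hγ).trans ?_
    refine mul_le_mul_of_nonneg_right ?_ hlog
    rw [mul_div_assoc]
    have := (hε t ht).1
    gcongr
    exact pow_le_of_le_one this.le (hε t ht).2 two_ne_zero
  have hsq : ∀ t < T, ∫ ω, ∑ j, q t ω j * X t ω j ^ 2 ∂μ ≤ (1 + R) ^ 2 * B t := fun t ht =>
    (hround t ht).integral_sum_mul_lossEstimate_sq_le (hε t ht).1 hγ (hs.nonneg t ht)
      (hs.le_one t ht) fun ω => sum_mul_observationProb_div_le hN (hε t ht).1 (hε t ht).2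
        (hs.self_eq_one t ht) ((hround t ht).prob_pos ω) ((hround t ht).prob_sum ω) hγ
  have hint1 : ∀ t ∈ Finset.range T, Integrable
      (fun ω => (∑ j, q t ω j * X t ω j) - X t ω i) μ := fun t ht => by
    rw [Finset.mem_range] at ht
    exact (integrable_finsetSum _ fun j _ => (hround t ht).integrable_mul_lossEstimate
      (hε t ht).1 hγ (hs.nonneg t ht) (hs.le_one t ht) j).sub
      ((hround t ht).integrable_lossEstimate (hε t ht).1 hγ (hs.nonneg t ht) (hs.le_one t ht) i)
  have hint2 : ∀ t ∈ Finset.range T, Integrable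
      (fun ω => ∑ j, q t ω j * X t ω j ^ 2) μ := fun t ht => by
    rw [Finset.mem_range] at ht
    exact integrable_finsetSum _ fun j _ => (hround t ht).integrable_mul_lossEstimate_sq
      (hε t ht).1 hγ (hs.nonneg t ht) (hs.le_one t ht) j
  have hsmall : ∀ᵐ ω ∂μ, ∀ t < T, ∀ j, |η * X t ω j| ≤ 1 := by
    simp_rw [ae_all_iff]
    intro t ht j
    filter_upwards [(hround t ht).ae_abs_lossEstimate_le (hε t ht).1 hγ (hs.nonneg t ht)
      (hs.le_one t ht) j] with ω hω
    rw [abs_mul, abs_of_pos hη]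
    calc η * |X t ω j| ≤ η * ((1 + R) / γ) := mul_le_mul_of_nonneg_left hω hη.le
      _ = η * (1 + R) / γ := (mul_div_assoc _ _ _).symm
      _ ≤ 1 := (div_le_one hγ).2 hηγ
  calc ∫ ω, ((∑ t ∈ Finset.range T, ℓ t (I t ω) ω) - ∑ t ∈ Finset.range T, ℓ t i ω) ∂μ
      = ∑ t ∈ Finset.range T, ∫ ω, (ℓ t (I t ω) ω - ℓ t i ω) ∂μ := by
        simp_rw [← Finset.sum_sub_distrib]
        exact integral_finsetSum _ fun t ht =>
          (hround t (Finset.mem_range.1 ht)).integrable_loss_arm.sub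
            ((hround t (Finset.mem_range.1 ht)).integrable_loss i)
    _ ≤ ∑ t ∈ Finset.range T, (∫ ω, ((∑ j, q t ω j * X t ω j) - X t ω i) ∂μ + γ * B t) :=
        Finset.sum_le_sum fun t ht => hregret t (Finset.mem_range.1 ht)
    _ = ∫ ω, ∑ t ∈ Finset.range T, ((∑ j, q t ω j * X t ω j) - X t ω i) ∂μ +
          γ * ∑ t ∈ Finset.range T, B t := by
        rw [Finset.sum_add_distrib, integral_finsetSum _ hint1, Finset.mul_sum]
    _ ≤ ∫ ω, (Real.log N / η + η * ∑ t ∈ Finset.range T, ∑ j, q t ω j * X t ω j ^ 2) ∂μ +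
          γ * ∑ t ∈ Finset.range T, B t := by
        refine add_le_add_left (integral_mono_ae (integrable_finsetSum _ hint1)
          ((integrable_const _).add ((integrable_finsetSum _ hint2).const_mul η)) ?_) _
        filter_upwards [hsmall] with ω hω
        exact expWeights_regret_le hN hη (fun t => L t ω) (fun t => X t ω) T (fun _ => rfl)
          (fun _ _ _ => rfl) hω i
    _ = Real.log N / η + η * (∑ t ∈ Finset.range T, ∫ ω, ∑ j, q t ω j * X t ω j ^ 2 ∂μ) +
          γ * ∑ t ∈ Finset.range T, B t := by
        rw [integral_add (integrable_const _) ((integrable_finsetSum _ hint2).const_mul η),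
          integral_const_mul, integral_finsetSum _ hint2]
        simp
    _ ≤ Real.log N / η + η * (∑ t ∈ Finset.range T, (1 + R) ^ 2 * B t) +
          γ * ∑ t ∈ Finset.range T, B t := by
        gcongr with t ht
        exact hsq t (Finset.mem_range.1 ht)
    _ = _ := by
        have hBsum : ∑ t ∈ Finset.range T, B t = 2 * Real.log (1 + 1 / γ) *
            ∑ t ∈ Finset.range T,
              (independenceNumber (thresholdGraph (s t) (ε t)) : ℝ) / ε t ^ 2 := by
          rw [Finset.mul_sum]
          exact Finset.sum_congr rfl fun t _ => by simp only [hB]; ring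
        rw [← Finset.mul_sum, hBsum]
        ring

end Regret

/-- The regret bound for arbitrary thresholds, with the parameters tuned. -/
theorem exists_regretAtMost {N T : ℕ} {R : ℝ} {s : ℕ → Fin N → Fin N → ℝ} {ε : ℕ → ℝ} (hN : 1 ≤ N)
    (hR : 0 ≤ R) (hs : IsObservationGraphs T s) (hε : ∀ t < T, ε t ∈ Set.Ioc (0 : ℝ) 1) :
    ∃ η γ : ℝ, 0 < η ∧ 0 ≤ γ ∧
      RegretAtMost.{u} T R s ε η γ
        (5 * (1 + Real.log (N * T)) ^ 1 * (1 + R) *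
          √(∑ t ∈ Finset.range T,
            (independenceNumber (thresholdGraph (s t) (ε t)) : ℝ) / ε t ^ 2)) := by
  set A : ℝ := ∑ t ∈ Finset.range T,
    (independenceNumber (thresholdGraph (s t) (ε t)) : ℝ) / ε t ^ 2 with hA
  have hterm : ∀ t ∈ Finset.range T,
      (1 : ℝ) ≤ (independenceNumber (thresholdGraph (s t) (ε t)) : ℝ) / ε t ^ 2 := fun t ht => by
    have he := hε t (Finset.mem_range.1 ht)
    have hα : (1 : ℝ) ≤ independenceNumber (thresholdGraph (s t) (ε t)) := by
      exact_mod_cast one_le_independenceNumber hN _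
    rw [one_le_div (pow_pos he.1 2)]
    exact (pow_le_one₀ he.1.le he.2).trans hα
  have hTA : (T : ℝ) ≤ A := by
    simpa using Finset.card_nsmul_le_sum _ _ _ hterm
  have hN1 : (1 : ℝ) ≤ N := by exact_mod_cast hN
  have hlogNT : 0 ≤ Real.log (N * T) := by
    rw [← Nat.cast_mul]
    exact Real.log_natCast_nonneg _
  have hsqrt := Real.sqrt_nonneg A
  rw [pow_one]
  -- When `T ≤ √A` the bound is trivial. In the other case `γ = 1 / √A` exceeds `1 / T`, which
  -- keeps the logarithm of `1 / γ` under control even for tiny thresholds.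
  rcases le_or_gt (T : ℝ) √A with hle | hlt
  · refine ⟨1, 0, one_pos, le_rfl, ?_⟩
    intro Ω mΩ μ 𝓕 ℓ ξ I hμ henv _
    refine (expectedRegret_le_card_rounds hN henv).trans (hle.trans ?_)
    refine le_mul_of_one_le_left hsqrt ?_
    nlinarith [mul_nonneg hlogNT hR]
  · have hTpos : (0 : ℝ) < T := hsqrt.trans_lt hlt
    have hT1 : (1 : ℝ) ≤ T := by
      exact_mod_cast Nat.one_le_iff_ne_zero.2 fun h => by simp [h] at hTpos
    have hApos : 0 < A := hTpos.trans_le hTA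
    have hr : 0 < √A := Real.sqrt_pos.2 hApos
    have hR1 : 0 < 1 + R := by linarith
    have hη : 0 < 1 / √A / (1 + R) := by positivity
    have hγ : 0 < 1 / √A := by positivity
    refine ⟨1 / √A / (1 + R), 1 / √A, hη, hγ.le, ?_⟩
    intro Ω mΩ μ 𝓕 ℓ ξ I hμ henv halg
    refine (expectedRegret_le hN hs hε hη hγ (div_mul_cancel₀ _ hR1.ne').le henv halg).trans ?_
    rw [← hA]
    have hlogN : Real.log N ≤ Real.log (N * T) :=
      Real.log_le_log (by linarith) (le_mul_of_one_le_right (by linarith) hT1)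
    have hlogγ : Real.log (1 + 1 / (1 / √A)) ≤ 1 + Real.log (N * T) := by
      rw [one_div_one_div]
      have h1 : Real.log (1 + √A) ≤ Real.log (2 * (N * T)) :=
        Real.log_le_log (by linarith) (by nlinarith)
      rw [Real.log_mul two_ne_zero (by positivity)] at h1
      linarith [Real.log_two_lt_d9]
    have hAr : A = √A * √A := (Real.mul_self_sqrt hApos.le).symm
    have hl0 : 0 ≤ Real.log (1 + 1 / (1 / √A)) := by
      rw [one_div_one_div]
      exact Real.log_nonneg (by linarith)
    set l := Real.log (1 + 1 / (1 / √A))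
    calc Real.log N / (1 / √A / (1 + R)) + (1 / √A / (1 + R) * (1 + R) ^ 2 + 1 / √A) * (2 * l * A)
        = (Real.log N * (1 + R) + (2 + R) * (2 * l)) * √A := by
          nth_rewrite 4 [hAr]
          field_simp
          ring
      _ ≤ ((1 + Real.log (N * T)) * (1 + R) + (2 * (1 + R)) * (2 * (1 + Real.log (N * T)))) *
            √A := by
          gcongr <;> linarith
      _ = _ := by ring

theorem theorem1 :
    ∃ (C : ℝ) (k : ℕ), 0 < C ∧
      ∀ (N T : ℕ) (R : ℝ) (s : ℕ → Fin N → Fin N → ℝ),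
        1 ≤ N → 0 ≤ R → IsObservationGraphs T s →
        (∀ ε : ℕ → ℝ, (∀ t < T, ε t ∈ Set.Ioc (0 : ℝ) 1) →
          ∃ η γ : ℝ, 0 < η ∧ 0 ≤ γ ∧
            RegretAtMost.{u} T R s ε η γ
              (C * (1 + Real.log (N * T)) ^ k * (1 + R) *
                √(∑ t ∈ Finset.range T,
                  (independenceNumber (thresholdGraph (s t) (ε t)) : ℝ) / ε t ^ 2))) ∧
        (∃ ε : ℕ → ℝ, ∀ t < T, IsOptimalThreshold (s t) (ε t)) ∧
        (∀ ε : ℕ → ℝ, (∀ t < T, IsOptimalThreshold (s t) (ε t)) →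
          ∃ η γ : ℝ, 0 < η ∧ 0 ≤ γ ∧
            RegretAtMost.{u} T R s ε η γ
              (C * (1 + Real.log (N * T)) ^ k * (1 + R) *
                √(∑ t ∈ Finset.range T, effectiveIndependenceNumber (s t)))) := by
  refine ⟨5, 1, by norm_num, fun N T R s hN hR hs => ⟨fun ε hε => exists_regretAtMost hN hR hs hε,
    ⟨fun t => (exists_isOptimalThreshold (s t)).choose,
      fun t _ => (exists_isOptimalThreshold (s t)).choose_spec⟩, fun ε hε => ?_⟩⟩
  rw [Finset.sum_congr rfl fun t ht =>
    (hε t (Finset.mem_range.1 ht)).effectiveIndependenceNumber_eq]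
  exact exists_regretAtMost hN hR hs fun t ht => (hε t ht).1
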